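/- **Setting.** A sender $\mathcal S$ and a receiver $\mathcal R$ are connected by $n$ channels, and there is no public channel. The message space $\mathcal M$ is finite with $|\mathcal M|\ge 2$. An SMT protocol $\Pi$ runs for a fixed number of rounds; in each round one of the two parties (according to a fixed schedule) sends, over every channel, a packet that is computed from its private random coins and the packets delivered to it so far (and, for $\mathcal S$, from the message $M_S\in\mathcal M$ to be sent). A packet contains a message or the blank symbol $\bot$, possibly together with the special message "DETECT". At the end $\mathcal R$ outputs $M_R$, which is a message in $\mathcal M$ or no message. Coins are drawn from discrete distributions, independently for all parties. A *$t$-adversary* $\mathcal A$ is computationally unbounded and randomized. It corrupts a set of at most $t$ channels, chosen from its coins. In every round it first sees the packets sent over the corrupted channels and then decides which packets are delivered on these channels. At the end it outputs a guess $M_A$. Its view $V_A(m,r_A)$ consists of the packets sent over the corrupted channels when $M_S=m$ and its coins are $r_A$. $\Pi$ is *$(\varepsilon,\delta)$-SMT against $\mathcal A$* if (correctness) for every $m\in\mathcal M$, if $M_S=m$ and the packets on the corrupted channels are not changed, then $\Pr[M_R=m]=1$; (privacy) for all $m_0,m_1\in\mathcal M$ and all coins $r_A$ of $\mathcal A$ of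 positive probability, the statistical distance of $V_A(m_0,r_A)$ and $V_A(m_1,r_A)$ is at most $\varepsilon$; (reliability) for every $m\in\mathcal M$, if $M_S=m$ then $\Pr[M_R\ne m]\le\delta$. In the *SMT game*, $M_S\in\mathcal M$ is uniformly random and $\Pi$ is run in the presence of $\mathcal A$. The outcome is $(\mathsf{guess},\mathsf{suc},\mathsf{detect})\in\{0,1\}^3$, where $\mathsf{guess}=1$ iff $M_A=M_S$, $\mathsf{suc}=1$ iff $M_R=M_S$, and $\mathsf{detect}=1$ iff $\mathcal S$ or $\mathcal R$ sends "DETECT" during the execution. For a utility function $U:\{0,1\}^3\to\mathbb R$, let $u(\mathcal A,U)$ be the expected value of $U$ at the outcome. $\Pi$ is *perfectly secure against a rational $t$-adversary with utility function $U$* if there is a $t$-adversary $\mathcal B$ such that $\Pi$ is $(0,0)$-SMT against $\mathcal B$, and $u(\mathcal A,U)\le u(\mathcal B,U)$ for every $t$-adversary $\mathcal A$. Let $U_{\mathsf{timid}}$ be the set of all $U$ such that, for all outcomes $\mathsf{out}=(\mathsf{guess},\mathsf{suc},\mathsf{detect})$ and $\mathsf{out}'=(\mathsf{guess}',\mathsf{suc}',\mathsf{detect}')$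 with $\mathsf{guess}=\mathsf{guess}'$: (1) $U(\mathsf{out})>U(\mathsf{out}')$ if $\mathsf{suc}<\mathsf{suc}'$ and $\mathsf{detect}=\mathsf{detect}'$; (2) $U(\mathsf{out})>U(\mathsf{out}')$ if $\mathsf{suc}=\mathsf{suc}'$ and $\mathsf{detect}<\mathsf{detect}'$. **Corollary.** Let $t\ge\lceil n/2\rceil$. There is no SMT protocol over $n$ channels without a public channel that, for every $U\in U_{\mathsf{timid}}$, is perfectly secure against a rational $t$-adversary with utility function $U$. -/

import Mathlib

namespace SMT

universe u

/-- The two honest parties. -/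
inductive Party where
  | sender
  | receiver

/-- What travels over one channel in one round: a message (`none` is the blank symbol `⊥`, i.e.
nothing is delivered), possibly accompanied by the special message "DETECT". -/
structure Packet (Msg : Type u) where
  body : Option Msg
  detect : Bool

/-- A protocol with message space `M` over `n` channels and no public channel.  All communication
consists of packets sent over the `n` channels.  In round `j < rounds`, the party `speaker j`
sends one packet over every channel.

A party is a function of its private coins, of the packets that were delivered to it in the
earlier rounds (most recent round first) and of the index of the current round; the sender also
has the message to be transmitted.  After the last round the receiver outputs a message, or
`none` if it outputs no message. -/
structure Protocol (M : Type u) (n : ℕ) where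
  Msg : Type u
  SCoins : Type u
  RCoins : Type u
  sCoins : PMF SCoins
  rCoins : PMF RCoins
  rounds : ℕ
  speaker : ℕ → Party
  sendS : M → SCoins → List (Fin n → Packet Msg) → ℕ → Fin n → Packet Msg
  sendR : RCoins → List (Fin n → Packet Msg) → ℕ → Fin n → Packet Msg
  output : RCoins → List (Fin n → Packet Msg) → Option M

variable {M : Type u} {n t : ℕ}

/-- A (computationally unbounded, rushing) `t`-adversary for the protocol `P`.  Depending on its
coins `r` it corrupts a set of at most `t` channels.  In each round (of either party) it sees the
packets sent over the corrupted channels, and only then chooses the packets delivered on these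
channels: `tamper r past cur` where `cur` is what is sent in the current round over the
corrupted channels and `past` lists what was sent there before (most recent round first).
At the end it outputs a guess of the transmitted message (`none`: something not in `M`). -/
structure Adversary (P : Protocol M n) (t : ℕ) where
  Coins : Type u
  coins : PMF Coins
  corrupt : Coins → Finset (Fin n)
  card_corrupt_le : ∀ r, (corrupt r).card ≤ t
  tamper : (r : Coins) → List (corrupt r → Packet P.Msg) → (corrupt r → Packet P.Msg) →
    (corrupt r → Packet P.Msg)
  guess : (r : Coins) → List (corrupt r → Packet P.Msg) → Option M

/-- The adversary that corrupts the same channels as `A` and only eavesdrops. -/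
def Adversary.passive {P : Protocol M n} (A : Adversary P t) : Adversary P t :=
  { A with tamper := fun _ _ cur => cur }

/-- The state of an execution: the packets delivered to the sender and to the receiver, the packets
seen by the adversary on the set `I` of corrupted channels (most recent round first), and whether
an honest party has sent "DETECT". -/
structure State (n : ℕ) (Msg : Type u) (I : Finset (Fin n)) where
  toS : List (Fin n → Packet Msg)
  toR : List (Fin n → Packet Msg)
  seen : List (I → Packet Msg)
  detected : Bool

namespace Protocol

/-- What is delivered when `p` is sent and the adversary puts `q` on the channels of `I`. -/
def deliver {Msg : Type u} (I : Finset (Fin n)) (p : Fin n → Packet Msg) (q : I → Packet Msg) :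
    Fin n → Packet Msg :=
  fun i => if h : i ∈ I then q ⟨i, h⟩ else p i

variable (P : Protocol M n) (A : Adversary P t)

/-- One round (round `j`) of the execution. -/
def step (m : M) (cS : P.SCoins) (cR : P.RCoins) (r : A.Coins) (j : ℕ)
    (st : State n P.Msg (A.corrupt r)) : State n P.Msg (A.corrupt r) :=
  let p : Fin n → Packet P.Msg :=
    match P.speaker j with
    | Party.sender => P.sendS m cS st.toS j
    | Party.receiver => P.sendR cR st.toR j
  let cur : A.corrupt r → Packet P.Msg := fun i => p i
  let d := deliver (A.corrupt r) p (A.tamper r st.seen cur)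
  { toS := match P.speaker j with
      | Party.sender => st.toS
      | Party.receiver => d :: st.toS
    toR := match P.speaker j with
      | Party.sender => d :: st.toR
      | Party.receiver => st.toR
    seen := cur :: st.seen
    detected := st.detected || decide (∃ i, (p i).detect = true) }

/-- The state after the first `k` rounds. -/
def run (m : M) (cS : P.SCoins) (cR : P.RCoins) (r : A.Coins) :
    ℕ → State n P.Msg (A.corrupt r)
  | 0 => { toS := [], toR := [], seen := [], detected := false }
  | k + 1 => P.step A m cS cR r k (run m cS cR r k)

/-- The state at the end of the execution. -/
def final (m : M) (cS : P.SCoins) (cR : P.RCoins) (r : A.Coins) : State n P.Msg (A.corrupt r) :=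
  P.run A m cS cR r P.rounds

/-- The message `M_R` output by the receiver. -/
def received (m : M) (cS : P.SCoins) (cR : P.RCoins) (r : A.Coins) : Option M :=
  P.output cR (P.final A m cS cR r).toR

/-- The distribution of `M_R` when `M_S = m`, over the coins of all the parties. -/
noncomputable def receivedDist (m : M) : PMF (Option M) :=
  P.sCoins.bind fun cS => P.rCoins.bind fun cR => A.coins.map fun r => P.received A m cS cR r

/-- The distribution of the view `V_A(m, r)` of the adversary when `M_S = m` and the coins of the
adversary are `r`, over the coins of the honest parties. -/
noncomputable def viewDist (m : M) (r : A.Coins) : PMF (List (A.corrupt r → Packet P.Msg)) :=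
  P.sCoins.bind fun cS => P.rCoins.map fun cR => (P.final A m cS cR r).seen

end Protocol

/-- Statistical distance of two discrete distributions. -/
noncomputable def statDist {Ω : Type*} (p q : PMF Ω) : ℝ :=
  (1 / 2) * ∑' x, |(p x).toReal - (q x).toReal|

/-- `P` is an `(ε, δ)`-SMT protocol against the adversary `A`. -/
structure IsSMTAgainst (P : Protocol M n) (ε δ : ℝ) (A : Adversary P t) : Prop where
  correctness : ∀ m : M, P.receivedDist A.passive m (some m) = 1
  privacy : ∀ m₀ m₁ : M, ∀ r ∈ A.coins.support,
    statDist (P.viewDist A m₀ r) (P.viewDist A m₁ r) ≤ ε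
  reliability : ∀ m : M, ((P.receivedDist A m).toOuterMeasure {x | x ≠ some m}).toReal ≤ δ

/-- The outcome `(guess, suc, detect)` of the SMT game, with `false < true` for `0 < 1`. -/
structure Outcome where
  guess : Bool
  suc : Bool
  detect : Bool

open Classical in
/-- The outcome of the SMT game for given coins and a given transmitted message `m`. -/
noncomputable def Protocol.outcome (P : Protocol M n) (A : Adversary P t) (m : M)
    (cS : P.SCoins) (cR : P.RCoins) (r : A.Coins) : Outcome where
  guess := decide (A.guess r (P.final A m cS cR r).seen = some m)
  suc := decide (P.received A m cS cR r = some m)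
  detect := (P.final A m cS cR r).detected

/-- The distribution of the outcome of the SMT game, in which the message is uniform in `M`. -/
noncomputable def Protocol.game [Fintype M] [Nonempty M] (P : Protocol M n) (A : Adversary P t) :
    PMF Outcome :=
  (PMF.uniformOfFintype M).bind fun m => P.sCoins.bind fun cS => P.rCoins.bind fun cR =>
    A.coins.map fun r => P.outcome A m cS cR r

/-- The utility `u(A, U)`: the expected value of `U` at the outcome of the SMT game. -/
noncomputable def Protocol.utility [Fintype M] [Nonempty M] (P : Protocol M n)
    (A : Adversary P t) (U : Outcome → ℝ) : ℝ :=
  ∑ g : Bool, ∑ s : Bool, ∑ d : Bool, (P.game A ⟨g, s, d⟩).toReal * U ⟨g, s, d⟩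

/-- `P` is perfectly secure against a rational `t`-adversary with utility function `U`. -/
def Protocol.PerfectlySecureRational [Fintype M] [Nonempty M] (P : Protocol M n) (t : ℕ)
    (U : Outcome → ℝ) : Prop :=
  ∃ B : Adversary P t, IsSMTAgainst P 0 0 B ∧
    ∀ A : Adversary P t, P.utility A U ≤ P.utility B U

/-- The set of utility functions of timid adversaries. -/
def timid : Set (Outcome → ℝ) :=
  {U | (∀ o o' : Outcome, o.guess = o'.guess → o.suc < o'.suc → o.detect = o'.detect →
          U o > U o') ∧
       (∀ o o' : Outcome, o.guess = o'.guess → o.suc = o'.suc → o.detect < o'.detect →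
          U o > U o')}

end SMT

/-!
If `n ≤ 2 * t`, the channels split into two parts of at most `t` channels each. Fix two messages
`m ≠ m'` and coins of the honest parties, and splice the executions for `m` and `m'`: one part of
the channels carries what a sender with message `m` would send, the other part what a sender with
message `m'` would send. An adversary corrupting either part can bring about this spliced execution,
against `m` or against `m'`, and the receiver's output is wrong in at least one of these two cases.

The adversary knows the coins of the honest parties only by guessing, so its attack succeeds merely
with some probability `q > 0`. A timid utility function that puts weight `2 / q` on making the
transmission fail nevertheless prefers this attack to every adversary against which the protocol is
perfectly reliable.
-/

namespace SMT

section Splicing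

/-- The packets delivered to the sender and to the receiver, most recent round first: the part of
the state of an execution that the honest parties see. -/
structure Inboxes (n : ℕ) (Msg : Type*) where
  toS : List (Fin n → Packet Msg)
  toR : List (Fin n → Packet Msg)

/-- What has been delivered to the honest parties in the state `st`. -/
def State.inboxes {n : ℕ} {Msg : Type*} {I : Finset (Fin n)} (st : State n Msg I) :
    Inboxes n Msg :=
  ⟨st.toS, st.toR⟩

namespace Protocol

theorem deliver_eq_of_forall {n : ℕ} {Msg : Type*} {I : Finset (Fin n)} {p d : Fin n → Packet Msg}
    {q : I → Packet Msg} (hp : ∀ i ∉ I, p i = d i) (hq : ∀ i : I, q i = d i) :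
    deliver I p q = d := by
  funext i
  by_cases hi : i ∈ I
  · simpa only [deliver, hi, dite_true] using hq ⟨i, hi⟩
  · simpa only [deliver, hi, dite_false] using hp i hi

variable {M : Type*} {n t : ℕ} (P : Protocol M n)

/-- The packets sent in round `j` when channel `i` is served by a sender with message `w i`; an
honest sender with message `m` is the case of constant `w`. -/
def sent (w : Fin n → M) (cS : P.SCoins) (cR : P.RCoins) (j : ℕ) (h : Inboxes n P.Msg) :
    Fin n → Packet P.Msg :=
  match P.speaker j with
  | Party.sender => fun i => P.sendS (w i) cS h.toS j i
  | Party.receiver => P.sendR cR h.toR j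

/-- The inboxes after the packets `d` have been delivered in round `j`. -/
def record (j : ℕ) (d : Fin n → Packet P.Msg) (h : Inboxes n P.Msg) : Inboxes n P.Msg :=
  match P.speaker j with
  | Party.sender => ⟨h.toS, d :: h.toR⟩
  | Party.receiver => ⟨d :: h.toS, h.toR⟩

/-- The inboxes after the first `k` rounds of the spliced execution, in which channel `i` is served
by a sender with message `w i` and nobody tampers. -/
def splicedInboxes (w : Fin n → M) (cS : P.SCoins) (cR : P.RCoins) : ℕ → Inboxes n P.Msg
  | 0 => ⟨[], []⟩
  | k + 1 =>
    let h := splicedInboxes w cS cR k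
    P.record k (P.sent w cS cR k h) h

/-- The receiver's output in the spliced execution. -/
def splicedOutput (w : Fin n → M) (cS : P.SCoins) (cR : P.RCoins) : Option M :=
  P.output cR (P.splicedInboxes w cS cR P.rounds).toR

/-- The deterministic adversary that corrupts the channels in `K` and delivers on them what they
carry in the spliced execution. The coins `cS` and `cR` are hardwired: they are the adversary's
guess of the coins of the honest parties. -/
noncomputable def spliceAttack (w : Fin n → M) (cS : P.SCoins) (cR : P.RCoins)
    (K : Finset (Fin n)) (hK : K.card ≤ t) : Adversary P t where
  Coins := PUnit
  coins := PMF.pure PUnit.unit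
  corrupt _ := K
  card_corrupt_le _ := hK
  tamper _ past _ i := P.sent w cS cR past.length (P.splicedInboxes w cS cR past.length) i
  guess _ _ := none

variable {P}

theorem sent_apply_congr {w w' : Fin n → M} {i : Fin n} (hw : w i = w' i) (cS : P.SCoins)
    (cR : P.RCoins) (j : ℕ) (h : Inboxes n P.Msg) :
    P.sent w cS cR j h i = P.sent w' cS cR j h i := by
  unfold sent
  cases P.speaker j <;> simp only [hw]

theorem length_seen_run (A : Adversary P t) (m : M) (cS : P.SCoins) (cR : P.RCoins) (r : A.Coins)
    (k : ℕ) : (P.run A m cS cR r k).seen.length = k := by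
  induction k with
  | zero => rfl
  | succ k ih => exact congrArg (· + 1) ih

theorem inboxes_run_succ (A : Adversary P t) (m : M) (cS : P.SCoins) (cR : P.RCoins) (r : A.Coins)
    (k : ℕ) :
    (P.run A m cS cR r (k + 1)).inboxes =
      let st := P.run A m cS cR r k
      let p := P.sent (fun _ => m) cS cR k st.inboxes
      P.record k (deliver (A.corrupt r) p (A.tamper r st.seen fun i => p i)) st.inboxes := by
  simp only [run, step, State.inboxes, record, sent]
  cases P.speaker k <;> rfl

variable {w : Fin n → M} {K : Finset (Fin n)} {m : M}

theorem tamper_run_spliceAttack (hK : K.card ≤ t) (cS : P.SCoins) (cR : P.RCoins)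
    (r : (P.spliceAttack w cS cR K hK).Coins) (k : ℕ)
    (cur : (P.spliceAttack w cS cR K hK).corrupt r → Packet P.Msg)
    (i : (P.spliceAttack w cS cR K hK).corrupt r) :
    let A := P.spliceAttack w cS cR K hK
    A.tamper r (P.run A m cS cR r k).seen cur i =
      P.sent w cS cR k (P.splicedInboxes w cS cR k) i :=
  congrArg (fun j => P.sent w cS cR j (P.splicedInboxes w cS cR j) i)
    (length_seen_run (P.spliceAttack w cS cR K hK) m cS cR r k)

theorem inboxes_run_spliceAttack (hK : K.card ≤ t) (hw : ∀ i ∉ K, w i = m) (cS : P.SCoins)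
    (cR : P.RCoins) (r : (P.spliceAttack w cS cR K hK).Coins) (k : ℕ) :
    (P.run (P.spliceAttack w cS cR K hK) m cS cR r k).inboxes = P.splicedInboxes w cS cR k := by
  induction k with
  | zero => rfl
  | succ k ih =>
    rw [inboxes_run_succ]
    dsimp only
    rw [ih]
    exact congrArg (P.record k · _) (deliver_eq_of_forall
      (fun i hi => sent_apply_congr (hw i hi).symm cS cR k _)
      (tamper_run_spliceAttack hK cS cR r k _))

theorem received_spliceAttack (hK : K.card ≤ t) (hw : ∀ i ∉ K, w i = m) (cS : P.SCoins)
    (cR : P.RCoins) (r : (P.spliceAttack w cS cR K hK).Coins) :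
    P.received (P.spliceAttack w cS cR K hK) m cS cR r = P.splicedOutput w cS cR :=
  congrArg (fun h : Inboxes n P.Msg => P.output cR h.toR)
    (inboxes_run_spliceAttack hK hw cS cR r P.rounds)

end Protocol

end Splicing

section Reliability

variable {M : Type*} {n t : ℕ} {P : Protocol M n}

/-- The receiver outputs the transmitted message for all coins of positive probability. -/
def IsPerfectlyReliable (P : Protocol M n) (A : Adversary P t) : Prop :=
  ∀ m, ∀ cS ∈ P.sCoins.support, ∀ cR ∈ P.rCoins.support, ∀ r ∈ A.coins.support,
    P.received A m cS cR r = some m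

theorem IsSMTAgainst.isPerfectlyReliable {ε : ℝ} {B : Adversary P t} (h : IsSMTAgainst P ε 0 B) :
    IsPerfectlyReliable P B := by
  intro m cS hcS cR hcR r hr
  have failure_eq_zero : (P.receivedDist B m).toOuterMeasure {x | x ≠ some m} = 0 := by
    have failure_ne_top : (P.receivedDist B m).toOuterMeasure {x | x ≠ some m} ≠ ⊤ := by
      rw [PMF.toOuterMeasure_apply]
      exact PMF.tsum_coe_indicator_ne_top _ _
    exact ((ENNReal.toReal_eq_zero_iff _).1
      ((h.reliability m).antisymm ENNReal.toReal_nonneg)).resolve_right failure_ne_top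
  have received_mem : P.received B m cS cR r ∈ (P.receivedDist B m).support := by
    simp only [Protocol.receivedDist, PMF.mem_support_bind_iff, PMF.mem_support_map_iff]
    exact ⟨cS, hcS, cR, hcR, r, hr, rfl⟩
  rw [PMF.toOuterMeasure_apply_eq_zero_iff, Set.disjoint_left] at failure_eq_zero
  exact not_not.1 (failure_eq_zero received_mem)

theorem IsPerfectlyReliable.splicedOutput_eq {w : Fin n → M} {cS : P.SCoins} {cR : P.RCoins}
    {K : Finset (Fin n)} {hK : K.card ≤ t} {m : M}
    (h : IsPerfectlyReliable P (P.spliceAttack w cS cR K hK)) (hcS : cS ∈ P.sCoins.support)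
    (hcR : cR ∈ P.rCoins.support) (hw : ∀ i ∉ K, w i = m) : P.splicedOutput w cS cR = some m := by
  rw [← Protocol.received_spliceAttack hK hw cS cR PUnit.unit]
  exact h m cS hcS cR hcR PUnit.unit ((PMF.mem_support_pure_iff _ _).2 rfl)

theorem exists_card_le_and_card_compl_le {α : Type*} [Fintype α] [DecidableEq α] {s t : ℕ}
    (h : Fintype.card α ≤ s + t) : ∃ I : Finset α, I.card ≤ s ∧ Iᶜ.card ≤ t := by
  obtain ⟨I, -, hI⟩ := Finset.exists_subset_card_eq
    (s := (Finset.univ : Finset α)) (n := min (Fintype.card α) s) (by simp)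
  have hIc := Finset.card_compl I
  exact ⟨I, by omega, by omega⟩

theorem exists_not_isPerfectlyReliable [Nontrivial M] (P : Protocol M n) (hnt : n ≤ 2 * t) :
    ∃ A : Adversary P t, ¬ IsPerfectlyReliable P A := by
  by_contra! hrel
  obtain ⟨m, m', hne⟩ := exists_pair_ne M
  obtain ⟨cS, hcS⟩ := P.sCoins.support_nonempty
  obtain ⟨cR, hcR⟩ := P.rCoins.support_nonempty
  obtain ⟨I, hI, hIc⟩ : ∃ I : Finset (Fin n), I.card ≤ t ∧ Iᶜ.card ≤ t :=
    exists_card_le_and_card_compl_le (by simpa [two_mul] using hnt)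
  let w : Fin n → M := fun i => if i ∈ I then m' else m
  have output_eq : P.splicedOutput w cS cR = some m :=
    (hrel (P.spliceAttack w cS cR I hI)).splicedOutput_eq hcS hcR fun i hi => if_neg hi
  have output_eq' : P.splicedOutput w cS cR = some m' :=
    (hrel (P.spliceAttack w cS cR Iᶜ hIc)).splicedOutput_eq hcS hcR fun i hi =>
      if_pos (by simpa using hi)
  exact hne (Option.some_injective _ (output_eq.symm.trans output_eq'))

theorem Protocol.outcome_suc_eq_true_iff (P : Protocol M n) (A : Adversary P t) (m : M)
    (cS : P.SCoins) (cR : P.RCoins) (r : A.Coins) :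
    (P.outcome A m cS cR r).suc = true ↔ P.received A m cS cR r = some m := by
  simp only [Protocol.outcome, decide_eq_true_iff]

theorem isPerfectlyReliable_iff_forall_mem_support_game [Fintype M] [Nonempty M]
    {A : Adversary P t} :
    IsPerfectlyReliable P A ↔ ∀ o ∈ (P.game A).support, o.suc = true := by
  simp only [Protocol.game, PMF.mem_support_bind_iff, PMF.mem_support_map_iff,
    PMF.support_uniformOfFintype, Set.top_eq_univ, Set.mem_univ, true_and]
  constructor
  · rintro h o ⟨m, cS, hcS, cR, hcR, r, hr, rfl⟩
    exact (P.outcome_suc_eq_true_iff ..).2 (h m cS hcS cR hcR r hr)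
  · intro h m cS hcS cR hcR r hr
    exact (P.outcome_suc_eq_true_iff ..).1 (h _ ⟨m, cS, hcS, cR, hcR, r, hr, rfl⟩)

end Reliability

section Expectation

variable {α : Type*} [Fintype α] (p : PMF α) {f : α → ℝ} {c : ℝ}

theorem sum_toReal_pmf : ∑ a, (p a).toReal = 1 := by
  rw [← ENNReal.toReal_sum fun a _ => p.apply_ne_top a, ← tsum_fintype (L := .unconditional _),
    p.tsum_coe, ENNReal.toReal_one]

theorem sum_toReal_pmf_mul_le (hf : ∀ a ∈ p.support, f a ≤ c) : ∑ a, (p a).toReal * f a ≤ c :=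
  calc ∑ a, (p a).toReal * f a
    _ ≤ ∑ a, (p a).toReal * c := by
      refine Finset.sum_le_sum fun a _ => ?_
      by_cases ha : a ∈ p.support
      · exact mul_le_mul_of_nonneg_left (hf a ha) ENNReal.toReal_nonneg
      · simp [(p.apply_eq_zero_iff a).2 ha]
    _ = c := by rw [← Finset.sum_mul, sum_toReal_pmf, one_mul]

theorem add_toReal_pmf_mul_le_sum (hf : ∀ a, c ≤ f a) (a : α) :
    c + (p a).toReal * (f a - c) ≤ ∑ b, (p b).toReal * f b :=
  calc c + (p a).toReal * (f a - c)
    _ ≤ c + ∑ b, (p b).toReal * (f b - c) := by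
      gcongr
      exact Finset.single_le_sum (f := fun b => (p b).toReal * (f b - c))
        (fun b _ => mul_nonneg ENNReal.toReal_nonneg (sub_nonneg.2 (hf b))) (Finset.mem_univ a)
    _ = ∑ b, (p b).toReal * f b := by
      simp only [mul_sub, Finset.sum_sub_distrib, ← Finset.sum_mul, sum_toReal_pmf]
      ring

end Expectation

section Utility

/-- An outcome as the triple `(guess, suc, detect)`. -/
def outcomeEquiv : Bool × Bool × Bool ≃ Outcome where
  toFun x := ⟨x.1, x.2.1, x.2.2⟩
  invFun o := (o.guess, o.suc, o.detect)

instance : Fintype Outcome := Fintype.ofEquiv _ outcomeEquiv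

/-- The utility function of an adversary that loses `L` if the transmission succeeds and `1` if it
is detected. -/
def disruptiveUtility (L : ℝ) (o : Outcome) : ℝ :=
  -(if o.suc then L else 0) - (if o.detect then 1 else 0)

theorem disruptiveUtility_mem_timid {L : ℝ} (hL : 0 < L) : disruptiveUtility L ∈ timid := by
  constructor
  · rintro ⟨g, s, d⟩ ⟨g', s', d'⟩ - hsuc hdetect
    obtain ⟨rfl, rfl⟩ := Bool.lt_iff.1 hsuc
    obtain rfl : d = d' := hdetect
    simp only [disruptiveUtility, Bool.false_eq_true, if_true, if_false]
    linarith
  · rintro ⟨g, s, d⟩ ⟨g', s', d'⟩ - hsuc hdetect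
    obtain ⟨rfl, rfl⟩ := Bool.lt_iff.1 hdetect
    obtain rfl : s = s' := hsuc
    simp [disruptiveUtility]

theorem disruptiveUtility_le {L : ℝ} {o : Outcome} (ho : o.suc = true) :
    disruptiveUtility L o ≤ -L := by
  simp only [disruptiveUtility, ho, if_true]
  split_ifs <;> linarith

theorem neg_one_le_disruptiveUtility (L : ℝ) {o : Outcome} (ho : o.suc = false) :
    -1 ≤ disruptiveUtility L o := by
  simp only [disruptiveUtility, ho, Bool.false_eq_true, if_false]
  split_ifs <;> linarith

theorem neg_sub_one_le_disruptiveUtility {L : ℝ} (hL : 0 ≤ L) (o : Outcome) :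
    -L - 1 ≤ disruptiveUtility L o := by
  unfold disruptiveUtility
  split_ifs <;> linarith

variable {M : Type*} [Fintype M] [Nonempty M] {n t : ℕ} {P : Protocol M n}

theorem utility_eq_sum (A : Adversary P t) (U : Outcome → ℝ) :
    P.utility A U = ∑ o, (P.game A o).toReal * U o := by
  rw [← outcomeEquiv.sum_comp]
  simp only [Protocol.utility, Fintype.sum_prod_type, outcomeEquiv, Equiv.coe_fn_mk]

theorem exists_timid_forall_utility_lt {A : Adversary P t} (hA : ¬ IsPerfectlyReliable P A) :
    ∃ U ∈ timid, ∀ B : Adversary P t, IsPerfectlyReliable P B → P.utility B U < P.utility A U := by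
  obtain ⟨o, ho, hsuc⟩ : ∃ o ∈ (P.game A).support, o.suc = false := by
    simpa [isPerfectlyReliable_iff_forall_mem_support_game] using hA
  set q := (P.game A o).toReal
  have hq : 0 < q := ENNReal.toReal_pos ho (PMF.apply_ne_top _ _)
  set L := 2 / q
  have hL : 0 < L := by positivity
  refine ⟨disruptiveUtility L, disruptiveUtility_mem_timid hL, fun B hB => ?_⟩
  calc P.utility B (disruptiveUtility L)
    _ ≤ -L := by
      rw [utility_eq_sum]
      exact sum_toReal_pmf_mul_le _ fun o ho =>
        disruptiveUtility_le (isPerfectlyReliable_iff_forall_mem_support_game.1 hB o ho)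
    _ < (-L - 1) + q * L := by
      rw [mul_div_cancel₀ 2 hq.ne']
      linarith
    _ ≤ (-L - 1) + q * (disruptiveUtility L o - (-L - 1)) := by
      gcongr
      linarith [neg_one_le_disruptiveUtility L hsuc]
    _ ≤ P.utility A (disruptiveUtility L) := by
      rw [utility_eq_sum]
      exact add_toReal_pmf_mul_le_sum _ (neg_sub_one_le_disruptiveUtility hL.le) o

end Utility

end SMT

theorem mainTheorem4 {M : Type*} [Fintype M] [Nontrivial M] (n t : ℕ)
    (ht : ⌈(n : ℝ) / 2⌉₊ ≤ t) :
    ¬ ∃ P : SMT.Protocol M n, ∀ U ∈ SMT.timid, P.PerfectlySecureRational t U := by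
  rintro ⟨P, hP⟩
  have hnt : n ≤ 2 * t := by exact_mod_cast (div_le_iff₀' two_pos).1 (Nat.ceil_le.1 ht)
  obtain ⟨A, hA⟩ := SMT.exists_not_isPerfectlyReliable P hnt
  obtain ⟨U, hU, hlt⟩ := SMT.exists_timid_forall_utility_lt hA
  obtain ⟨B, hB, hmax⟩ := hP U hU
  exact (hmax A).not_gt (hlt B hB.isPerfectlyReliable)
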